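/- Let $E=(E^0,E^1,r,s)$ be an arbitrary directed graph (no restriction on the cardinalities of $E^0$ and $E^1$, nor on the number of edges emitted by a vertex) and let $K$ be any field. The Leavitt path algebra $L_K(E)$ is the associative, not necessarily unital, $K$-algebra generated by a set $\{v : v\in E^0\}$ of pairwise orthogonal idempotents together with elements $\{e,e^* : e\in E^1\}$, subject to the relations (1) $s(e)e=e=e\,r(e)$ for all $e\in E^1$; (2) $r(e)e^*=e^*=e^*s(e)$ for all $e\in E^1$; (3) $e^*e=r(e)$ and $e^*f=0$ for all $e,f\in E^1$ with $e\neq f$; (4) $v=\sum_{e\in E^1,\,s(e)=v}ee^*$ for every $v\in E^0$ such that $s^{-1}(v)$ is finite and non-empty. A ring $R$ (not necessarily unital) is called primitive if it has a faithful simple left module or a faithful simple right module, where a module $M$ is simple if its action is non-zero and $0$, $M$ are its only submodules. A ring $R$ is called a Zorn ring if for every $a\in R$, either $a$ is nilpotent or there is $b\in R$ such that $ab$ is a non-zero idempotent. If the Leavitt path algebra $L_K(E)$ is a primitive ring, then $L_K(E)$ is a Zorn ring. -/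

import Mathlib

universe u v w

/-! ### Zorn rings and primitive rings (associative, not necessarily unital) -/

/-- `IsNilpotentElem a`: some power `a ^ (n + 1)`, `n ≥ 0`, vanishes. The ring need not have an
identity, so only positive powers make sense. -/
def IsNilpotentElem {R : Type u} [NonUnitalRing R] (a : R) : Prop :=
  ∃ n : ℕ, (fun x : R => a * x)^[n] a = 0

/-- A ring is a Zorn ring if for every element `a`, either `a` is nilpotent or there is `b` such
that `a * b` is a non-zero idempotent. -/
def IsZornRing (R : Type u) [NonUnitalRing R] : Prop :=
  ∀ a : R, IsNilpotentElem a ∨ ∃ b : R, a * b ≠ 0 ∧ IsIdempotentElem (a * b)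

/-- A left module over a not necessarily unital ring `R`, given by its structure map
`ρ : R → End M`, is simple if `R M ≠ 0` and `M` has no submodules besides `0` and `M`. -/
def IsSimpleRep {R : Type u} [NonUnitalRing R] {M : Type v} [AddCommGroup M]
    (ρ : R →ₙ+* AddMonoid.End M) : Prop :=
  (∃ (r : R) (m : M), ρ r m ≠ 0) ∧
    ∀ N : AddSubgroup M, (∀ (r : R), ∀ x ∈ N, ρ r x ∈ N) → N = ⊥ ∨ N = ⊤

/-- A ring is left primitive if it has a faithful simple left module. (A simple left module is of
the form `R m`, so it is enough to consider modules in the universe of `R`.) -/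
def IsLeftPrimitiveRing (R : Type u) [NonUnitalRing R] : Prop :=
  ∃ (M : Type u) (_ : AddCommGroup M) (ρ : R →ₙ+* AddMonoid.End M),
    IsSimpleRep ρ ∧ Function.Injective ρ

/-- A ring is right primitive if it has a faithful simple right module, that is, if the opposite
ring is left primitive. -/
def IsRightPrimitiveRing (R : Type u) [NonUnitalRing R] : Prop :=
  IsLeftPrimitiveRing Rᵐᵒᵖ

/-- A ring is primitive if it is left primitive or right primitive. -/
def IsPrimitiveRing (R : Type u) [NonUnitalRing R] : Prop :=
  IsLeftPrimitiveRing R ∨ IsRightPrimitiveRing R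

/-! ### Directed graphs and Leavitt path algebras -/

/-- A directed graph: a set of vertices, a set of edges, and source and range maps. -/
structure DirectedGraph where
  /-- The vertices. -/
  V : Type u
  /-- The edges. -/
  E : Type v
  /-- The source of an edge. -/
  s : E → V
  /-- The range of an edge. -/
  r : E → V

namespace DirectedGraph

/-- The generators of the Leavitt path algebra: vertices, edges and ghost edges. -/
inductive Gen (G : DirectedGraph.{u, v}) : Type (max u v)
  | vertex (a : G.V) : Gen G
  | edge (e : G.E) : Gen G
  | ghost (e : G.E) : Gen G

/-- The free associative `K`-algebra without identity on the generators: the semigroup algebra of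
the free semigroup (nonempty words). -/
abbrev FreeAlg (K : Type w) [Field K] (G : DirectedGraph.{u, v}) : Type (max u v w) :=
  MonoidAlgebra K (FreeSemigroup G.Gen)

section Relations

variable (K : Type w) [Field K] (G : DirectedGraph.{u, v})

/-- A vertex as an element of the free algebra. -/
noncomputable def fvertex (a : G.V) : FreeAlg K G :=
  MonoidAlgebra.single (FreeSemigroup.of (Gen.vertex a)) 1

/-- An edge as an element of the free algebra. -/
noncomputable def fedge (e : G.E) : FreeAlg K G :=
  MonoidAlgebra.single (FreeSemigroup.of (Gen.edge e)) 1

/-- A ghost edge as an element of the free algebra. -/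
noncomputable def fghost (e : G.E) : FreeAlg K G :=
  MonoidAlgebra.single (FreeSemigroup.of (Gen.ghost e)) 1

/-- The defining relations of the Leavitt path algebra. -/
inductive LeavittRel : FreeAlg K G → FreeAlg K G → Prop
  | vertex_idem (a : G.V) : LeavittRel (fvertex K G a * fvertex K G a) (fvertex K G a)
  | vertex_orth (a b : G.V) (h : a ≠ b) : LeavittRel (fvertex K G a * fvertex K G b) 0
  | source_edge (e : G.E) : LeavittRel (fvertex K G (G.s e) * fedge K G e) (fedge K G e)
  | edge_range (e : G.E) : LeavittRel (fedge K G e * fvertex K G (G.r e)) (fedge K G e)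
  | range_ghost (e : G.E) : LeavittRel (fvertex K G (G.r e) * fghost K G e) (fghost K G e)
  | ghost_source (e : G.E) : LeavittRel (fghost K G e * fvertex K G (G.s e)) (fghost K G e)
  | ghost_edge (e : G.E) : LeavittRel (fghost K G e * fedge K G e) (fvertex K G (G.r e))
  | ghost_edge_ne (e f : G.E) (h : e ≠ f) : LeavittRel (fghost K G e * fedge K G f) 0
  | regular (a : G.V) (hfin : {e : G.E | G.s e = a}.Finite)
      (hne : {e : G.E | G.s e = a}.Nonempty) :
      LeavittRel (fvertex K G a) (∑ e ∈ hfin.toFinset, fedge K G e * fghost K G e)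

/-- The smallest congruence of `K`-algebras on the free algebra containing the defining relations.
Without an identity, closure under scalars is not automatic, so the scalar multiples of the
relations are put in as well. -/
noncomputable def leavittCon : RingCon (FreeAlg K G) :=
  ringConGen fun x y => ∃ (k : K) (x' y' : FreeAlg K G),
    LeavittRel K G x' y' ∧ x = k • x' ∧ y = k • y'

end Relations

/-- The Leavitt path algebra `L_K(G)`: the associative `K`-algebra (in general without identity)
with the vertices, edges and ghost edges as generators, subject to the defining relations. -/
def LeavittPathAlgebra (K : Type w) [Field K] (G : DirectedGraph.{u, v}) : Type (max u v w) :=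
  (leavittCon K G).Quotient

namespace LeavittPathAlgebra

variable (K : Type w) [Field K] (G : DirectedGraph.{u, v})

noncomputable instance : NonUnitalRing (LeavittPathAlgebra K G) :=
  inferInstanceAs (NonUnitalRing (leavittCon K G).Quotient)

/-- The congruence is compatible with the scalars. -/
theorem leavittCon_smul (k : K) {x y : FreeAlg K G} (h : leavittCon K G x y) :
    leavittCon K G (k • x) (k • y) := by
  change RingConGen.Rel _ x y at h
  change RingConGen.Rel _ (k • x) (k • y)
  induction h with
  | of x y h =>
    obtain ⟨l, x', y', h, rfl, rfl⟩ := h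
    exact .of _ _ ⟨k * l, x', y', h, by rw [mul_smul], by rw [mul_smul]⟩
  | refl x => exact .refl _
  | symm _ ih => exact .symm ih
  | trans _ _ ih₁ ih₂ => exact .trans ih₁ ih₂
  | add _ _ ih₁ ih₂ => rw [smul_add, smul_add]; exact .add ih₁ ih₂
  | mul _ h₂ ih₁ _ => rw [← smul_mul_assoc, ← smul_mul_assoc]; exact .mul ih₁ h₂

noncomputable instance : Module K (LeavittPathAlgebra K G) where
  smul k := Quotient.map' (fun x => k • x) fun _ _ h => leavittCon_smul K G k h
  one_smul := by
    rintro ⟨x⟩; exact congrArg Quotient.mk'' (one_smul K x)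
  mul_smul := by
    rintro k l ⟨x⟩; exact congrArg Quotient.mk'' (mul_smul k l x)
  smul_zero := fun k => congrArg Quotient.mk'' (smul_zero (A := FreeAlg K G) k)
  smul_add := by
    rintro k ⟨x⟩ ⟨y⟩; exact congrArg Quotient.mk'' (smul_add k x y)
  add_smul := by
    rintro k l ⟨x⟩; exact congrArg Quotient.mk'' (add_smul k l x)
  zero_smul := by
    rintro ⟨x⟩; exact congrArg Quotient.mk'' (zero_smul K x)

instance : IsScalarTower K (LeavittPathAlgebra K G) (LeavittPathAlgebra K G) where
  smul_assoc := by
    rintro k ⟨x⟩ ⟨y⟩; exact congrArg Quotient.mk'' (smul_mul_assoc k x y)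

instance : SMulCommClass K (LeavittPathAlgebra K G) (LeavittPathAlgebra K G) where
  smul_comm := by
    rintro k ⟨x⟩ ⟨y⟩; exact congrArg Quotient.mk'' (mul_smul_comm k x y).symm

end LeavittPathAlgebra

end DirectedGraph

/-!
A primitive Leavitt path algebra satisfies Condition (L), every closed path has an exit, and
Condition (L) makes a Leavitt path algebra a Zorn ring.

*Condition (L) implies Zorn.* Every non-zero `a` has a two-sided multiple `x * a * y` that is a
non-zero multiple `k v` of a vertex (`reduces_of_ne_zero`); then `k⁻¹ a y v x` is a non-zero
idempotent (`Reduces.exists_idempotent`). To find `x` and `y`, write `a v` as a combination of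
products `α β*` of paths and ghost paths. Multiplying by edges on the right shortens the ghost paths
`β*` until a non-trivial combination of distinct paths with common end is left (`reduces_of_mem`).
Multiplying on the left by the ghost of a shortest of these paths gives `k v + c`, with `c` a
combination of closed paths at `v` of positive length (`exists_mul_ofPaths_eq`). Conjugating by a
path that leaves one of the closed paths at an exit kills it and turns the others into zero or closed
paths again, so in the end only a multiple of a vertex is left (`ClosedSum.reduces`).

*Primitive implies Condition (L).* If `l` is a closed path at `a` without exits, then any path from
`a` runs around `l`, so that the corner at `a` is commutative (`commute_corner`). A commutative
corner of a primitive ring is a field (`IsPrimitiveRing.exists_inverse`). But `a - l*` is non-zero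
and not invertible in the corner. Both facts, and `a ≠ 0` for all vertices `a`, are read off from an
action on the functions on a set that resembles the infinite paths, graded by the integers: over
`a`, functions of the degree are shifted by `l*`, so constants are fixed.
-/

namespace DirectedGraph

/-! ### Paths in a directed graph -/

section Paths

variable {G : DirectedGraph.{u, v}}

/-- `G.IsPath a l`: the list of edges `l` is a path starting at the vertex `a`. The starting vertex
is recorded separately so that the empty list gives a path of length zero at every vertex. -/
def IsPath (G : DirectedGraph.{u, v}) : G.V → List G.E → Prop
  | _, [] => True
  | a, e :: l => G.s e = a ∧ G.IsPath (G.r e) l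

/-- The vertex at which the path `l` from `a` ends. -/
def endpoint (G : DirectedGraph.{u, v}) : G.V → List G.E → G.V
  | a, [] => a
  | _, e :: l => G.endpoint (G.r e) l

theorem endpoint_append (a : G.V) (l m : List G.E) :
    G.endpoint a (l ++ m) = G.endpoint (G.endpoint a l) m := by
  induction l generalizing a with
  | nil => rfl
  | cons e l ih => exact ih _

theorem isPath_append (a : G.V) (l m : List G.E) :
    G.IsPath a (l ++ m) ↔ G.IsPath a l ∧ G.IsPath (G.endpoint a l) m := by
  induction l generalizing a with
  | nil => simp [IsPath, endpoint]
  | cons e l ih => simp [IsPath, endpoint, ih, and_assoc]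

/-- `G.IsClosedPath a l`: `l` is a closed path of positive length based at `a`. -/
structure IsClosedPath (G : DirectedGraph.{u, v}) (a : G.V) (l : List G.E) : Prop where
  isPath : G.IsPath a l
  endpoint_eq : G.endpoint a l = a
  ne_nil : l ≠ []

/-- Condition (L), stated for closed paths: each of them has an exit. Repeated vertices are allowed
in a closed path, which does not matter, as a closed path without an exit runs around a cycle
without an exit. -/
def ConditionL (G : DirectedGraph.{u, v}) : Prop :=
  ∀ a l, G.IsClosedPath a l → ∃ e ∈ l, ∃ f, f ≠ e ∧ G.s f = G.s e

/-- Along a path without exits there is no choice. -/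
theorem IsPath.prefix_of_no_exit {a : G.V} {l m : List G.E} (hl : G.IsPath a l)
    (hm : G.IsPath a m) (hexit : ∀ e ∈ m, ∀ f, G.s f = G.s e → f = e)
    (hlen : l.length ≤ m.length) : l <+: m := by
  induction l generalizing a m with
  | nil => exact List.nil_prefix
  | cons e l ih =>
    match m with
    | [] => simp at hlen
    | f :: m =>
      obtain rfl : e = f := hexit f (by simp) e (hl.1.trans hm.1.symm)
      rw [List.cons_prefix_cons]
      exact ⟨rfl, ih hl.2 hm.2 (fun e he => hexit e (by simp [he])) (by simpa using hlen)⟩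

end Paths

namespace LeavittPathAlgebra

variable {K : Type w} [Field K] {G : DirectedGraph.{u, v}}

/-! ### Generators and relations -/

/-- The projection of the free algebra onto the Leavitt path algebra. -/
noncomputable def proj (K : Type w) [Field K] (G : DirectedGraph.{u, v}) :
    FreeAlg K G →ₗ[K] LeavittPathAlgebra K G where
  toFun x := (x : (leavittCon K G).Quotient)
  map_add' _ _ := rfl
  map_smul' _ _ := rfl

theorem proj_mul (x y : FreeAlg K G) : proj K G (x * y) = proj K G x * proj K G y := rfl

theorem proj_surjective : Function.Surjective (proj K G) := by
  rintro ⟨x⟩; exact ⟨x, rfl⟩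

theorem proj_eq_of_rel {x y : FreeAlg K G} (h : LeavittRel K G x y) :
    proj K G x = proj K G y :=
  (RingCon.eq (leavittCon K G)).2 (RingConGen.Rel.of _ _ ⟨1, x, y, h, by simp, by simp⟩)

/-- The class of a vertex. -/
noncomputable def vertex (K : Type w) [Field K] (a : G.V) : LeavittPathAlgebra K G :=
  proj K G (fvertex K G a)

/-- The class of an edge. -/
noncomputable def edge (K : Type w) [Field K] (e : G.E) : LeavittPathAlgebra K G :=
  proj K G (fedge K G e)

/-- The class of a ghost edge. -/
noncomputable def ghost (K : Type w) [Field K] (e : G.E) : LeavittPathAlgebra K G :=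
  proj K G (fghost K G e)

@[simp] theorem vertex_mul_self (a : G.V) : vertex K a * vertex K a = vertex K a :=
  proj_eq_of_rel (.vertex_idem a)

theorem vertex_mul_of_ne {a b : G.V} (h : a ≠ b) : vertex K a * vertex K b = 0 :=
  proj_eq_of_rel (.vertex_orth a b h)

@[simp] theorem vertex_mul_edge (e : G.E) : vertex K (G.s e) * edge K e = edge K e :=
  proj_eq_of_rel (.source_edge e)

@[simp] theorem edge_mul_vertex (e : G.E) : edge K e * vertex K (G.r e) = edge K e :=
  proj_eq_of_rel (.edge_range e)

@[simp] theorem vertex_mul_ghost (e : G.E) : vertex K (G.r e) * ghost K e = ghost K e :=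
  proj_eq_of_rel (.range_ghost e)

@[simp] theorem ghost_mul_vertex (e : G.E) : ghost K e * vertex K (G.s e) = ghost K e :=
  proj_eq_of_rel (.ghost_source e)

@[simp] theorem ghost_mul_edge (e : G.E) : ghost K e * edge K e = vertex K (G.r e) :=
  proj_eq_of_rel (.ghost_edge e)

theorem ghost_mul_edge_of_ne {e f : G.E} (h : e ≠ f) : ghost K e * edge K f = 0 :=
  proj_eq_of_rel (.ghost_edge_ne e f h)

theorem vertex_eq_sum (a : G.V) (F : Finset G.E) (hF : ∀ e, e ∈ F ↔ G.s e = a)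
    (hne : F.Nonempty) : vertex K a = ∑ e ∈ F, edge K e * ghost K e := by
  have hfin : {e : G.E | G.s e = a}.Finite := F.finite_toSet.subset fun e he => (hF e).2 he
  obtain rfl : F = hfin.toFinset := by ext e; simp [hF]
  have h := proj_eq_of_rel (K := K) (.regular a hfin ⟨_, (hF _).1 hne.choose_spec⟩)
  rw [map_sum] at h
  exact h

theorem vertex_mul_edge_of_ne {a : G.V} {e : G.E} (h : a ≠ G.s e) :
    vertex K a * edge K e = 0 := by
  rw [← vertex_mul_edge, ← mul_assoc, vertex_mul_of_ne h, zero_mul]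

/-- A subspace that contains the generators and is stable under left multiplication by them is the
whole algebra. -/
theorem eq_top_of_generators_mem (S : Submodule K (LeavittPathAlgebra K G))
    (hv : ∀ a, vertex K a ∈ S) (he : ∀ e, edge K e ∈ S) (hg : ∀ e, ghost K e ∈ S)
    (mul_v : ∀ a, ∀ x ∈ S, vertex K a * x ∈ S) (mul_e : ∀ e, ∀ x ∈ S, edge K e * x ∈ S)
    (mul_g : ∀ e, ∀ x ∈ S, ghost K e * x ∈ S) : S = ⊤ := by
  refine Submodule.eq_top_iff'.2 fun x => ?_
  obtain ⟨x, rfl⟩ := proj_surjective x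
  induction x using MonoidAlgebra.induction_linear with
  | zero => rw [map_zero]; exact S.zero_mem
  | add x y hx hy => rw [map_add]; exact S.add_mem hx hy
  | single m k =>
    rw [← mul_one k, ← smul_eq_mul, ← MonoidAlgebra.smul_single, map_smul]
    refine S.smul_mem _ ?_
    induction m using FreeSemigroup.recOnMul with
    | ih1 g => cases g with
      | vertex a => exact hv a
      | edge e => exact he e
      | ghost e => exact hg e
    | ih2 g m _ ih =>
      rw [← mul_one (1 : K), ← MonoidAlgebra.single_mul_single, proj_mul]
      cases g with
      | vertex a => exact mul_v a _ ih
      | edge e => exact mul_e e _ ih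
      | ghost e => exact mul_g e _ ih

/-! ### Real and ghost paths -/

/-- The element of the Leavitt path algebra given by the path `l` from `a`; it is zero if `l` is
not a path from `a`. -/
noncomputable def path (K : Type w) [Field K] : G.V → List G.E → LeavittPathAlgebra K G
  | a, [] => vertex K a
  | a, e :: l => vertex K a * (edge K e * path K (G.r e) l)

/-- The ghost of the path `l` from `a`; it is zero if `l` is not a path from `a`. -/
noncomputable def gpath (K : Type w) [Field K] : G.V → List G.E → LeavittPathAlgebra K G
  | a, [] => vertex K a
  | a, e :: l => gpath K (G.r e) l * ghost K e * vertex K a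

@[simp] theorem path_nil (a : G.V) : path K a [] = vertex K a := rfl

@[simp] theorem gpath_nil (a : G.V) : gpath K a [] = vertex K a := rfl

theorem path_cons (e : G.E) (l : List G.E) :
    path K (G.s e) (e :: l) = edge K e * path K (G.r e) l := by
  rw [path, ← mul_assoc, vertex_mul_edge]

theorem gpath_cons (e : G.E) (l : List G.E) :
    gpath K (G.s e) (e :: l) = gpath K (G.r e) l * ghost K e := by
  rw [gpath, mul_assoc, ghost_mul_vertex]

@[simp] theorem path_singleton (e : G.E) : path K (G.s e) [e] = edge K e := by
  rw [path_cons, path_nil, edge_mul_vertex]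

@[simp] theorem gpath_singleton (e : G.E) : gpath K (G.s e) [e] = ghost K e := by
  rw [gpath_cons, gpath_nil, vertex_mul_ghost]

@[simp] theorem vertex_mul_path (a : G.V) (l : List G.E) :
    vertex K a * path K a l = path K a l := by
  cases l with
  | nil => exact vertex_mul_self a
  | cons e l => rw [path, ← mul_assoc, vertex_mul_self]

@[simp] theorem gpath_mul_vertex (a : G.V) (l : List G.E) :
    gpath K a l * vertex K a = gpath K a l := by
  cases l with
  | nil => exact vertex_mul_self a
  | cons e l => rw [gpath, mul_assoc, vertex_mul_self]

theorem vertex_mul_path_of_ne {a b : G.V} (h : a ≠ b) (l : List G.E) :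
    vertex K a * path K b l = 0 := by
  rw [← vertex_mul_path, ← mul_assoc, vertex_mul_of_ne h, zero_mul]

theorem gpath_mul_vertex_of_ne {a b : G.V} (h : a ≠ b) (l : List G.E) :
    gpath K a l * vertex K b = 0 := by
  rw [← gpath_mul_vertex, mul_assoc, vertex_mul_of_ne h, mul_zero]

@[simp] theorem path_mul_vertex (a : G.V) (l : List G.E) :
    path K a l * vertex K (G.endpoint a l) = path K a l := by
  induction l generalizing a with
  | nil => exact vertex_mul_self a
  | cons e l ih => rw [path, endpoint, mul_assoc, mul_assoc, ih]

@[simp] theorem vertex_mul_gpath (a : G.V) (l : List G.E) :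
    vertex K (G.endpoint a l) * gpath K a l = gpath K a l := by
  induction l generalizing a with
  | nil => exact vertex_mul_self a
  | cons e l ih => rw [gpath, endpoint, ← mul_assoc, ← mul_assoc, ih]

theorem path_mul_vertex_of_ne {a b : G.V} {l : List G.E} (h : G.endpoint a l ≠ b) :
    path K a l * vertex K b = 0 := by
  rw [← path_mul_vertex, mul_assoc, vertex_mul_of_ne h, mul_zero]

theorem vertex_mul_gpath_of_ne {a b : G.V} {l : List G.E} (h : b ≠ G.endpoint a l) :
    vertex K b * gpath K a l = 0 := by
  rw [← vertex_mul_gpath, ← mul_assoc, vertex_mul_of_ne h, zero_mul]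

theorem path_eq_zero {a : G.V} {l : List G.E} (h : ¬ G.IsPath a l) : path K a l = 0 := by
  induction l generalizing a with
  | nil => exact absurd trivial h
  | cons e l ih =>
    by_cases hs : G.s e = a
    · rw [path, ih fun hl => h ⟨hs, hl⟩, mul_zero, mul_zero]
    · rw [path, ← mul_assoc, vertex_mul_edge_of_ne (Ne.symm hs), zero_mul]

theorem gpath_eq_zero {a : G.V} {l : List G.E} (h : ¬ G.IsPath a l) : gpath K a l = 0 := by
  induction l generalizing a with
  | nil => exact absurd trivial h
  | cons e l ih =>
    by_cases hs : G.s e = a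
    · rw [gpath, ih fun hl => h ⟨hs, hl⟩, zero_mul, zero_mul]
    · rw [gpath, mul_assoc, ← ghost_mul_vertex, mul_assoc, vertex_mul_of_ne hs, mul_zero, mul_zero]

theorem path_mul_path (a : G.V) (l m : List G.E) :
    path K a l * path K (G.endpoint a l) m = path K a (l ++ m) := by
  induction l generalizing a with
  | nil => exact vertex_mul_path a m
  | cons e l ih => rw [List.cons_append, path, path, endpoint, mul_assoc, mul_assoc, ih]

theorem gpath_mul_gpath (a : G.V) (l m : List G.E) :
    gpath K (G.endpoint a l) m * gpath K a l = gpath K a (l ++ m) := by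
  induction l generalizing a with
  | nil => exact gpath_mul_vertex a m
  | cons e l ih => rw [List.cons_append, gpath, gpath, endpoint, ← mul_assoc, ← mul_assoc, ih]

theorem gpath_mul_path_self {a : G.V} {l : List G.E} (h : G.IsPath a l) :
    gpath K a l * path K a l = vertex K (G.endpoint a l) := by
  induction l generalizing a with
  | nil => exact vertex_mul_self a
  | cons e l ih =>
    obtain ⟨rfl, h⟩ := h
    rw [gpath_cons, path_cons, mul_assoc, ← mul_assoc (ghost K e), ghost_mul_edge,
      vertex_mul_path, ih h, endpoint]

/-- A ghost path times a path at least as long is zero, unless the first is the ghost of an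
initial segment of the second; then what remains is the rest of the second. -/
theorem gpath_mul_path {a b : G.V} {l m : List G.E} (hl : G.IsPath a l) (hm : G.IsPath b m)
    (hlen : l.length ≤ m.length) :
    (a = b ∧ ∃ m', m = l ++ m' ∧ gpath K a l * path K b m = path K (G.endpoint a l) m') ∨
      gpath K a l * path K b m = 0 := by
  by_cases hab : a = b
  swap
  · right
    rw [← gpath_mul_vertex, mul_assoc, vertex_mul_path_of_ne hab, mul_zero]
  subst hab
  induction l generalizing a m with
  | nil => exact .inl ⟨rfl, m, rfl, vertex_mul_path a m⟩
  | cons e l ih =>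
    match m with
    | [] => simp at hlen
    | f :: m =>
      obtain ⟨rfl, hl⟩ := hl
      obtain ⟨hs, hm⟩ := hm
      by_cases hef : e = f
      · subst hef
        have h : gpath K (G.s e) (e :: l) * path K (G.s e) (e :: m)
            = gpath K (G.r e) l * path K (G.r e) m := by
          rw [gpath_cons, path_cons, mul_assoc, ← mul_assoc (ghost K e), ghost_mul_edge,
            vertex_mul_path]
        rw [h]
        rcases ih hl (by simpa using hlen) hm with ⟨-, m', rfl, h'⟩ | h'
        · exact .inl ⟨rfl, m', rfl, h'⟩
        · exact .inr h'
      · right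
        rw [gpath_cons, ← hs, path_cons, mul_assoc, ← mul_assoc (ghost K e),
          ghost_mul_edge_of_ne hef, zero_mul, mul_zero]

/-- The Leavitt path algebra is spanned by the products of a path and a ghost path. -/
theorem span_path_mul_gpath (K : Type w) [Field K] (G : DirectedGraph.{u, v}) :
    Submodule.span K {x : LeavittPathAlgebra K G |
      ∃ a l b m, x = path K a l * gpath K b m} = ⊤ := by
  set S := Submodule.span K {x : LeavittPathAlgebra K G |
      ∃ a l b m, x = path K a l * gpath K b m}
  have mem (a l b m) : path K a l * gpath K b m ∈ S :=
    Submodule.subset_span ⟨a, l, b, m, rfl⟩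
  have mul_mem (y : LeavittPathAlgebra K G)
      (hy : ∀ a l b m, y * (path K a l * gpath K b m) ∈ S) (x) (hx : x ∈ S) : y * x ∈ S := by
    induction hx using Submodule.span_induction with
    | mem x hx => obtain ⟨a, l, b, m, rfl⟩ := hx; exact hy a l b m
    | zero => rw [mul_zero]; exact S.zero_mem
    | add x z _ _ hx hz => rw [mul_add]; exact S.add_mem hx hz
    | smul k x _ hx => rw [mul_smul_comm]; exact S.smul_mem _ hx
  refine eq_top_of_generators_mem S (fun a => ?_) (fun e => ?_) (fun e => ?_)
    (fun c => mul_mem _ fun a l b m => ?_) (fun e => mul_mem _ fun a l b m => ?_)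
    (fun e => mul_mem _ fun a l b m => ?_)
  · simpa using mem a [] a []
  · simpa using mem (G.s e) [e] (G.r e) []
  · simpa using mem (G.r e) [] (G.s e) [e]
  · by_cases h : c = a
    · subst h
      rw [← mul_assoc, vertex_mul_path]; exact mem _ _ _ _
    · rw [← mul_assoc, vertex_mul_path_of_ne h, zero_mul]; exact S.zero_mem
  · by_cases h : G.r e = a
    · subst h
      rw [← mul_assoc, ← path_cons]; exact mem _ _ _ _
    · rw [← edge_mul_vertex, mul_assoc, ← mul_assoc (vertex K _), vertex_mul_path_of_ne h,
        zero_mul, mul_zero]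
      exact S.zero_mem
  · by_cases ha : G.s e = a
    swap
    · rw [← ghost_mul_vertex, mul_assoc, ← mul_assoc (vertex K _), vertex_mul_path_of_ne ha,
        zero_mul, mul_zero]
      exact S.zero_mem
    subst ha
    cases l with
    | nil =>
      rw [path_nil, ← mul_assoc, ghost_mul_vertex]
      by_cases hb : G.s e = G.endpoint b m
      · have := mem (G.r e) [] b (m ++ [e])
        rwa [← gpath_mul_gpath, ← hb, gpath_singleton, path_nil, ← mul_assoc,
          vertex_mul_ghost] at this
      · rw [← ghost_mul_vertex, mul_assoc, vertex_mul_gpath_of_ne hb, mul_zero]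
        exact S.zero_mem
    | cons f l =>
      rw [path, ← mul_assoc, ← mul_assoc, ghost_mul_vertex, ← mul_assoc (ghost K e)]
      by_cases hef : e = f
      · subst hef
        rw [ghost_mul_edge, vertex_mul_path]; exact mem _ _ _ _
      · rw [ghost_mul_edge_of_ne hef, zero_mul, zero_mul]; exact S.zero_mem

end LeavittPathAlgebra
end DirectedGraph

namespace DirectedGraph
namespace LeavittPathAlgebra

variable {K : Type w} [Field K] {G : DirectedGraph.{u, v}}

/-! ### Reduction to a vertex under Condition (L) -/

/-- Some two-sided multiple `x * a * y` of `a` is a non-zero multiple of a vertex. -/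
def Reduces (a : LeavittPathAlgebra K G) : Prop :=
  ∃ (x y : LeavittPathAlgebra K G) (v : G.V) (k : K), k ≠ 0 ∧ x * a * y = k • vertex K v

theorem Reduces.of_mul_left {a : LeavittPathAlgebra K G} (z : LeavittPathAlgebra K G)
    (h : Reduces (z * a)) : Reduces a := by
  obtain ⟨x, y, v, k, hk, h⟩ := h
  exact ⟨x * z, y, v, k, hk, by rw [← h, mul_assoc x z]⟩

theorem Reduces.of_mul_right {a : LeavittPathAlgebra K G} (z : LeavittPathAlgebra K G)
    (h : Reduces (a * z)) : Reduces a := by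
  obtain ⟨x, y, v, k, hk, h⟩ := h
  exact ⟨x, z * y, v, k, hk, by rw [← h, ← mul_assoc, ← mul_assoc x a]⟩

/-- `ClosedSum v n c`: the element `c` is a linear combination of `n` closed paths of positive
length based at `v`, not necessarily distinct. -/
inductive ClosedSum (v : G.V) : ℕ → LeavittPathAlgebra K G → Prop
  | zero : ClosedSum v 0 0
  | add {n : ℕ} {c : LeavittPathAlgebra K G} (k : K) {l : List G.E} (hl : G.IsClosedPath v l)
      (hc : ClosedSum v n c) : ClosedSum v (n + 1) (k • path K v l + c)

/-- Conjugating a closed path by a path `t` gives zero or again a closed path; in the second case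
`t` is an initial segment of the closed path followed by `t`. -/
theorem conj_closedPath {v : G.V} {l t : List G.E} (hl : G.IsClosedPath v l)
    (ht : G.IsPath v t) :
    (t <+: l ++ t ∧ ∃ l', G.IsClosedPath (G.endpoint v t) l' ∧
      gpath K v t * path K v l * path K v t = path K (G.endpoint v t) l') ∨
      gpath K v t * path K v l * path K v t = 0 := by
  have hlt : path K v l * path K v t = path K v (l ++ t) := by
    rw [← path_mul_path, hl.endpoint_eq]
  have hpath : G.IsPath v (l ++ t) := by
    rw [isPath_append, hl.endpoint_eq]; exact ⟨hl.isPath, ht⟩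
  rw [mul_assoc, hlt]
  rcases gpath_mul_path (K := K) ht hpath (by simp) with ⟨-, m, hm, h⟩ | h
  · refine .inl ⟨⟨m, hm.symm⟩, m, ⟨?_, ?_, ?_⟩, h⟩
    · rw [hm, isPath_append] at hpath; exact hpath.2
    · rw [← endpoint_append, ← hm, endpoint_append, hl.endpoint_eq]
    · rintro rfl
      have := congrArg List.length hm
      simp only [List.length_append, List.length_nil] at this
      exact hl.ne_nil (List.length_eq_zero_iff.1 (by omega))
  · exact .inr h

theorem ClosedSum.conj {v : G.V} {n : ℕ} {c : LeavittPathAlgebra K G} (hc : ClosedSum v n c)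
    {t : List G.E} (ht : G.IsPath v t) :
    ∃ m ≤ n, ClosedSum (G.endpoint v t) m (gpath K v t * c * path K v t) := by
  induction hc with
  | zero => exact ⟨0, le_rfl, by simpa using ClosedSum.zero⟩
  | @add n c k l hl hc ih =>
    obtain ⟨m, hm, ih⟩ := ih
    rw [mul_add, add_mul, mul_smul_comm, smul_mul_assoc]
    rcases conj_closedPath (K := K) hl ht with ⟨-, l', hl', h⟩ | h
    · rw [h]; exact ⟨m + 1, by omega, ih.add k hl'⟩
    · rw [h, smul_zero, zero_add]; exact ⟨m, by omega, ih⟩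

theorem conj_smul_vertex_add {v : G.V} {t : List G.E} (ht : G.IsPath v t) (k : K)
    (c : LeavittPathAlgebra K G) :
    gpath K v t * (k • vertex K v + c) * path K v t
      = k • vertex K (G.endpoint v t) + gpath K v t * c * path K v t := by
  rw [mul_add, add_mul, mul_smul_comm, smul_mul_assoc, gpath_mul_vertex, gpath_mul_path_self ht]

/-- Conjugating by a path that leaves a given closed path at an exit kills that closed path, and
turns the others into closed paths or zero. So the number of closed paths can be lowered until
only the multiple of the vertex is left. -/
theorem ClosedSum.reduces (hL : G.ConditionL) {v : G.V} {n : ℕ} {c : LeavittPathAlgebra K G}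
    (hc : ClosedSum v n c) {k : K} (hk : k ≠ 0) : Reduces (k • vertex K v + c) := by
  induction n using Nat.strong_induction_on generalizing v c with
  | _ n ih =>
    cases hc with
    | zero =>
      exact ⟨vertex K v, vertex K v, v, k, hk, by
        rw [add_zero, mul_smul_comm, smul_mul_assoc, vertex_mul_self, vertex_mul_self]⟩
    | @add n c k' l hl hc =>
      obtain ⟨e, he, f, hfe, hf⟩ := hL v l hl
      obtain ⟨p, q, rfl⟩ := List.mem_iff_append.1 he
      have hp := (isPath_append _ _ _).1 hl.isPath
      have ht : G.IsPath v (p ++ [f]) := by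
        rw [isPath_append]
        exact ⟨hp.1, hf.trans hp.2.1, trivial⟩
      have h0 : gpath K v (p ++ [f]) * path K v (p ++ e :: q) * path K v (p ++ [f]) = 0 := by
        rcases conj_closedPath (K := K) hl ht with ⟨h, -⟩ | h
        · rw [List.append_assoc, List.prefix_append_right_inj, List.cons_append,
            List.cons_prefix_cons] at h
          exact absurd h.1 hfe
        · exact h
      obtain ⟨m, hm, hc'⟩ := hc.conj ht
      refine .of_mul_left (gpath K v (p ++ [f])) (.of_mul_right (path K v (p ++ [f])) ?_)
      rw [conj_smul_vertex_add ht, mul_add, add_mul, mul_smul_comm, smul_mul_assoc, h0, smul_zero,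
        zero_add]
      exact ih m (by omega) hc'

/-- A path ending at `v`, as its starting vertex with its list of edges. -/
abbrev PathTo (G : DirectedGraph.{u, v}) (v : G.V) : Type (max u v) :=
  {p : G.V × List G.E // G.IsPath p.1 p.2 ∧ G.endpoint p.1 p.2 = v}

/-- The linear combination of paths ending at `v` with given coefficients. -/
noncomputable def ofPaths (K : Type w) [Field K] (v : G.V) :
    (PathTo G v →₀ K) →ₗ[K] LeavittPathAlgebra K G :=
  Finsupp.linearCombination K fun p => path K p.1.1 p.1.2

theorem ofPaths_apply (v : G.V) (p : PathTo G v →₀ K) :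
    ofPaths K v p = ∑ α ∈ p.support, p α • path K α.1.1 α.1.2 :=
  Finsupp.linearCombination_apply K p

theorem ofPaths_mul_vertex (v : G.V) (p : PathTo G v →₀ K) :
    ofPaths K v p * vertex K v = ofPaths K v p := by
  rw [ofPaths_apply, Finset.sum_mul]
  refine Finset.sum_congr rfl fun α _ => ?_
  have h := path_mul_vertex (K := K) α.1.1 α.1.2
  rw [α.2.2] at h
  rw [smul_mul_assoc, h]

theorem exists_closedSum_sum {ι : Type*} (v : G.V) (s : Finset ι) (k : ι → K)
    (x : ι → LeavittPathAlgebra K G)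
    (hx : ∀ i ∈ s, (∃ l, G.IsClosedPath v l ∧ x i = path K v l) ∨ x i = 0) :
    ∃ n, ClosedSum v n (∑ i ∈ s, k i • x i) := by
  classical
  induction s using Finset.induction_on with
  | empty => exact ⟨0, by simpa using ClosedSum.zero⟩
  | insert i s hi ih =>
    obtain ⟨n, ih⟩ := ih fun j hj => hx j (Finset.mem_insert_of_mem hj)
    rw [Finset.sum_insert hi]
    rcases hx i (Finset.mem_insert_self _ _) with ⟨l, hl, h⟩ | h
    · rw [h]; exact ⟨n + 1, ih.add _ hl⟩
    · rw [h, smul_zero, zero_add]; exact ⟨n, ih⟩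

/-- Multiplying by the ghost of a shortest path that occurs in a non-trivial combination of distinct
paths ending at `v`, one obtains a non-zero multiple of `v` plus a combination of closed paths. -/
theorem exists_mul_ofPaths_eq {v : G.V} {p : PathTo G v →₀ K} (hp : p ≠ 0) :
    ∃ (x c : LeavittPathAlgebra K G) (k : K) (n : ℕ), k ≠ 0 ∧ ClosedSum v n c ∧
      x * ofPaths K v p = k • vertex K v + c := by
  classical
  obtain ⟨α, hα, hmin⟩ := p.support.exists_min_image (fun β => β.1.2.length)
    (Finsupp.support_nonempty_iff.2 hp)
  set x := gpath K α.1.1 α.1.2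
  have hx : ∀ β ∈ p.support.erase α,
      (∃ l, G.IsClosedPath v l ∧ x * path K β.1.1 β.1.2 = path K v l) ∨
        x * path K β.1.1 β.1.2 = 0 := by
    intro β hβ
    rw [Finset.mem_erase] at hβ
    rcases gpath_mul_path (K := K) α.2.1 β.2.1 (hmin β hβ.2) with ⟨hab, m, hm, h⟩ | h
    · refine .inl ⟨m, ⟨?_, ?_, ?_⟩, ?_⟩
      · have := β.2.1
        rw [hm, ← hab, isPath_append, α.2.2] at this
        exact this.2
      · have := β.2.2
        rwa [hm, ← hab, endpoint_append, α.2.2] at this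
      · rintro rfl
        refine hβ.1 (Subtype.ext (Prod.ext hab.symm ?_))
        rw [hm, List.append_nil]
      · rw [h, α.2.2]
    · exact .inr h
  obtain ⟨n, hn⟩ := exists_closedSum_sum v _ p _ hx
  refine ⟨x, _, p α, n, Finsupp.mem_support_iff.1 hα, hn, ?_⟩
  have h := gpath_mul_path_self (K := K) α.2.1
  rw [α.2.2] at h
  rw [ofPaths_apply, Finset.mul_sum,
    ← Finset.add_sum_erase _ _ hα, mul_smul_comm, h]
  exact congrArg _ (Finset.sum_congr rfl fun β _ => mul_smul_comm _ _ _)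

/-- The combinations of products `α β*` of paths and ghost paths where `β` starts at `v` and has
length at most `n`. -/
noncomputable def ghostLengthLE (K : Type w) [Field K] (G : DirectedGraph.{u, v}) :
    ℕ → G.V → Submodule K (LeavittPathAlgebra K G)
  | 0, v => LinearMap.range (ofPaths K v)
  | n + 1, v => LinearMap.range (ofPaths K v) ⊔ ⨆ f : {f : G.E // G.s f = v},
      (ghostLengthLE K G n (G.r f.1)).map (LinearMap.mulRight K (ghost K f.1))

theorem ghostLengthLE_le_succ (n : ℕ) (v : G.V) :
    ghostLengthLE K G n v ≤ ghostLengthLE K G (n + 1) v := by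
  induction n generalizing v with
  | zero => exact le_sup_left
  | succ n ih => exact sup_le_sup_left (iSup_mono fun f => Submodule.map_mono (ih _)) _

theorem ghostLengthLE_mono {n m : ℕ} (h : n ≤ m) (v : G.V) :
    ghostLengthLE K G n v ≤ ghostLengthLE K G m v :=
  monotone_nat_of_le_succ (f := fun n => ghostLengthLE K G n v)
    (fun n => ghostLengthLE_le_succ n v) h

theorem path_mul_gpath_mem (a : G.V) (l : List G.E) (b : G.V) (m : List G.E) :
    path K a l * gpath K b m ∈ ghostLengthLE K G m.length b := by
  induction m generalizing b with
  | nil =>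
    by_cases h : G.IsPath a l ∧ G.endpoint a l = b
    · obtain ⟨h, rfl⟩ := h
      rw [gpath_nil, path_mul_vertex]
      exact ⟨Finsupp.single ⟨(a, l), h, rfl⟩ 1, by simp [ofPaths]⟩
    · rw [gpath_nil]
      have : path K a l * vertex K b = 0 := by
        by_cases h' : G.IsPath a l
        · exact path_mul_vertex_of_ne fun h'' => h ⟨h', h''⟩
        · rw [path_eq_zero h', zero_mul]
      rw [this]; exact Submodule.zero_mem _
  | cons f m ih =>
    by_cases hs : G.s f = b
    · subst hs
      rw [gpath_cons, ← mul_assoc]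
      refine Submodule.mem_sup_right (Submodule.mem_iSup_of_mem ⟨f, rfl⟩ ?_)
      exact ⟨_, ih (G.r f), rfl⟩
    · rw [gpath_eq_zero (fun h : G.IsPath b (f :: m) => hs h.1), mul_zero]; exact Submodule.zero_mem _

theorem exists_mul_vertex_mem (a : LeavittPathAlgebra K G) (v : G.V) :
    ∃ n, a * vertex K v ∈ ghostLengthLE K G n v := by
  have ha : a ∈ Submodule.span K {x : LeavittPathAlgebra K G |
      ∃ a l b m, x = path K a l * gpath K b m} := by
    rw [span_path_mul_gpath]; exact Submodule.mem_top
  induction ha using Submodule.span_induction with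
  | mem x hx =>
    obtain ⟨a, l, b, m, rfl⟩ := hx
    by_cases h : b = v
    · subst h
      rw [mul_assoc, gpath_mul_vertex]; exact ⟨_, path_mul_gpath_mem _ _ _ _⟩
    · rw [mul_assoc, gpath_mul_vertex_of_ne h, mul_zero]; exact ⟨0, Submodule.zero_mem _⟩
  | zero => rw [zero_mul]; exact ⟨0, Submodule.zero_mem _⟩
  | add x y _ _ hx hy =>
    obtain ⟨n, hx⟩ := hx
    obtain ⟨m, hy⟩ := hy
    rw [add_mul]
    exact ⟨max n m, Submodule.add_mem _ (ghostLengthLE_mono (le_max_left _ _) v hx)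
      (ghostLengthLE_mono (le_max_right _ _) v hy)⟩
  | smul k x _ hx =>
    obtain ⟨n, hx⟩ := hx
    rw [smul_mul_assoc]
    exact ⟨n, Submodule.smul_mem _ _ hx⟩

theorem exists_mul_vertex_ne_zero {a : LeavittPathAlgebra K G} (ha : a ≠ 0) :
    ∃ v, a * vertex K v ≠ 0 := by
  classical
  have key (x : LeavittPathAlgebra K G) :
      ∃ F : Finset G.V, ∀ F', F ⊆ F' → x * ∑ v ∈ F', vertex K v = x := by
    have hx : x ∈ Submodule.span K {x : LeavittPathAlgebra K G |
        ∃ a l b m, x = path K a l * gpath K b m} := by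
      rw [span_path_mul_gpath]; exact Submodule.mem_top
    induction hx using Submodule.span_induction with
    | mem x hx =>
      obtain ⟨a, l, b, m, rfl⟩ := hx
      refine ⟨{b}, fun F' hF' => ?_⟩
      rw [mul_assoc, Finset.mul_sum, Finset.sum_eq_single b, gpath_mul_vertex]
      · exact fun c _ hc => gpath_mul_vertex_of_ne hc.symm m
      · exact fun h => absurd (hF' (Finset.mem_singleton_self b)) h
    | zero => exact ⟨∅, fun F' _ => zero_mul _⟩
    | add x y _ _ hx hy =>
      obtain ⟨F, hF⟩ := hx
      obtain ⟨F₂, hF₂⟩ := hy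
      refine ⟨F ∪ F₂, fun F' h => ?_⟩
      rw [add_mul, hF F' (Finset.union_subset_left h), hF₂ F' (Finset.union_subset_right h)]
    | smul k x _ hx =>
      obtain ⟨F, hF⟩ := hx
      exact ⟨F, fun F' h => by rw [smul_mul_assoc, hF F' h]⟩
  obtain ⟨F, hF⟩ := key a
  by_contra! h
  apply ha
  rw [← hF F subset_rfl, Finset.mul_sum, Finset.sum_eq_zero fun v _ => h v]

theorem mul_vertex_of_mem_ghostLengthLE {n : ℕ} {v : G.V} {a : LeavittPathAlgebra K G}
    (ha : a ∈ ghostLengthLE K G n v) : a * vertex K v = a := by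
  have real {a : LeavittPathAlgebra K G} (h : a ∈ LinearMap.range (ofPaths K v)) :
      a * vertex K v = a := by
    obtain ⟨p, rfl⟩ := h
    exact ofPaths_mul_vertex v p
  cases n with
  | zero => exact real ha
  | succ n =>
    obtain ⟨x, hx, y, hy, rfl⟩ := Submodule.mem_sup.1 ha
    rw [add_mul, real hx]
    congr 1
    clear ha
    induction hy using Submodule.iSup_induction' with
    | mem f y hy =>
      obtain ⟨z, -, rfl⟩ := hy
      obtain ⟨f, rfl⟩ := f
      rw [LinearMap.mulRight_apply, mul_assoc, ghost_mul_vertex]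
    | zero => exact zero_mul _
    | add y z _ _ hy hz =>
      rw [add_mul, hy, hz]

theorem exists_ofPaths_eq_mul_edge (e : G.E) (p : PathTo G (G.s e) →₀ K) :
    ∃ q, ofPaths K (G.r e) q = ofPaths K (G.s e) p * edge K e := by
  change _ ∈ LinearMap.range (ofPaths K (G.r e))
  rw [ofPaths_apply, Finset.sum_mul]
  refine Submodule.sum_mem _ fun α _ => ?_
  rw [smul_mul_assoc]
  refine Submodule.smul_mem _ _ ⟨Finsupp.single ⟨(α.1.1, α.1.2 ++ [e]), ?_, ?_⟩ 1, ?_⟩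
  · rw [isPath_append]
    exact ⟨α.2.1, α.2.2.symm, trivial⟩
  · rw [endpoint_append]; rfl
  · have h := path_mul_path (K := K) α.1.1 α.1.2 [e]
    rw [α.2.2, path_singleton] at h
    rw [ofPaths, Finsupp.linearCombination_single, one_smul, h]

/-- Ghost edges can be removed by multiplying by edges on the right. The summand `ofPaths K v p`
makes the induction on the ghost length go through. -/
theorem reduces_of_mem (hL : G.ConditionL) (n : ℕ) (v : G.V) (p : PathTo G v →₀ K)
    {a : LeavittPathAlgebra K G} (ha : a ∈ ghostLengthLE K G n v)
    (hne : ofPaths K v p + a ≠ 0) : Reduces (ofPaths K v p + a) := by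
  classical
  -- without ghost edges
  have real (v : G.V) (q : PathTo G v →₀ K) (hq : ofPaths K v q ≠ 0) :
      Reduces (ofPaths K v q) := by
    obtain ⟨x, c, k, n, hk, hc, h⟩ := exists_mul_ofPaths_eq (p := q)
      fun h => hq (by rw [h, map_zero])
    refine .of_mul_left x ?_
    rw [h]; exact hc.reduces hL hk
  induction n generalizing v a with
  | zero =>
    obtain ⟨q, rfl⟩ := ha
    rw [← map_add] at hne ⊢
    exact real _ _ hne
  | succ n ih =>
    rw [ghostLengthLE] at ha
    obtain ⟨_, ⟨q, rfl⟩, g, hg, rfl⟩ := Submodule.mem_sup.1 ha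
    rw [Submodule.mem_iSup_iff_exists_finsupp] at hg
    obtain ⟨b, hb, rfl⟩ := hg
    rw [← add_assoc, ← map_add] at hne ⊢
    set P := ofPaths K v (p + q) with hP
    -- multiplying by an edge singles out one term
    have hmul (i : {f : G.E // G.s f = v}) :
        (P + b.sum fun _ x => x) * edge K i.1 = P * edge K i.1 + b i * edge K i.1 := by
      rw [add_mul, Finsupp.sum, Finset.sum_mul, Finset.sum_eq_single i]
      · intro j _ hji
        obtain ⟨z, -, hz⟩ := hb j
        rw [← hz, LinearMap.mulRight_apply, mul_assoc,
          ghost_mul_edge_of_ne fun h => hji (Subtype.ext h), mul_zero]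
      · intro hi
        rw [Finsupp.notMem_support_iff.1 hi, zero_mul]
    have hbe (i : {f : G.E // G.s f = v}) :
        b i * edge K i.1 ∈ ghostLengthLE K G n (G.r i.1) ∧
          b i * edge K i.1 * ghost K i.1 = b i := by
      obtain ⟨z, hz, h⟩ := hb i
      rw [← h, LinearMap.mulRight_apply, mul_assoc z, ghost_mul_edge,
        mul_vertex_of_mem_ghostLengthLE hz]
      exact ⟨hz, rfl⟩
    by_cases hex : ∃ i : {f : G.E // G.s f = v}, (P + b.sum fun _ x => x) * edge K i.1 ≠ 0
    · obtain ⟨i, hi⟩ := hex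
      refine .of_mul_right (edge K i.1) ?_
      rw [hmul] at hi ⊢
      obtain ⟨i, rfl⟩ := i
      obtain ⟨q', hq'⟩ := exists_ofPaths_eq_mul_edge i (p + q)
      rw [hP, ← hq'] at hi ⊢
      exact ih _ q' (hbe ⟨i, rfl⟩).1 hi
    push Not at hex
    have hbP (i : {f : G.E // G.s f = v}) : b i = - (P * (edge K i.1 * ghost K i.1)) := by
      have h := hex i
      rw [hmul, add_eq_zero_iff_eq_neg'] at h
      rw [← (hbe i).2, h, neg_mul, mul_assoc]
    have hP0 : P ≠ 0 := by
      intro h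
      refine hne ?_
      have hb0 : b = 0 := by
        ext i
        rw [hbP i, h, zero_mul, neg_zero, Finsupp.zero_apply]
      rw [h, hb0, Finsupp.sum_zero_index, add_zero]
    by_cases hall : ∀ i, i ∈ b.support
    · have hF : ∀ e, e ∈ b.support.map (Function.Embedding.subtype _) ↔ G.s e = v := by
        intro e
        simp only [Finset.mem_map, Function.Embedding.subtype_apply]
        exact ⟨fun ⟨i, _, h⟩ => h ▸ i.2, fun h => ⟨⟨e, h⟩, hall _, rfl⟩⟩
      rcases b.support.eq_empty_or_nonempty with h0 | h0
      · rw [Finsupp.support_eq_empty.1 h0, Finsupp.sum_zero_index, add_zero]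
        exact real _ _ hP0
      -- `v` is regular and all its edges occur, so the element is `P - P * v = 0`
      · refine absurd ?_ hne
        have hv := vertex_eq_sum (K := K) v _ hF (h0.map)
        rw [Finset.sum_map] at hv
        rw [Finsupp.sum, Finset.sum_congr rfl fun i _ => hbP i, Finset.sum_neg_distrib,
          ← Finset.mul_sum]
        erw [← hv]
        rw [hP, ofPaths_mul_vertex, add_neg_cancel]
    -- an edge `i` missing from the ghost part kills that part; to reduce `P * i`, reduce `P` to
    -- `k • v + c` with closed paths in `c`, and conjugate by `i`
    · push Not at hall
      obtain ⟨i, hi⟩ := hall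
      refine .of_mul_right (edge K i.1) ?_
      rw [hmul, Finsupp.notMem_support_iff.1 hi, zero_mul, add_zero]
      obtain ⟨i, rfl⟩ := i
      obtain ⟨x, c, k, m, hk, hc, h⟩ := exists_mul_ofPaths_eq (p := p + q)
        fun h => hP0 (by rw [hP, h, map_zero])
      have ht : G.IsPath (G.s i) [i] := ⟨rfl, trivial⟩
      obtain ⟨m', -, hc'⟩ := hc.conj ht
      have h' := conj_smul_vertex_add ht k c
      rw [← h, path_singleton] at h'
      refine .of_mul_left (gpath K (G.s i) [i] * x) ?_
      rw [← mul_assoc, mul_assoc _ x P, h', ← path_singleton]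
      exact hc'.reduces hL hk

theorem reduces_of_ne_zero (hL : G.ConditionL) {a : LeavittPathAlgebra K G} (ha : a ≠ 0) :
    Reduces a := by
  obtain ⟨v, hv⟩ := exists_mul_vertex_ne_zero ha
  obtain ⟨n, hn⟩ := exists_mul_vertex_mem a v
  have h := reduces_of_mem hL n v 0 hn
  rw [map_zero, zero_add] at h
  exact .of_mul_right _ (h hv)

end LeavittPathAlgebra
end DirectedGraph

namespace DirectedGraph
namespace LeavittPathAlgebra

/-! ### A graded representation on functions -/

section Representation

/-- Labels for the points over a vertex. All that matters is that this set is non-empty and in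
bijection with its product with `s⁻¹(a)` for every vertex `a` that is not a sink: a point over `a`
can then be treated like a path from `a` that is infinite or ends in a sink, with a first edge and a
tail. -/
abbrev Label (G : DirectedGraph.{u, v}) : Type v := ℕ ⊕ G.E

theorem nonempty_label_equiv (G : DirectedGraph.{u, v}) (a : G.V) (h : Nonempty {e // G.s e = a}) :
    Nonempty (Label G ≃ {e // G.s e = a} × Label G) := by
  rw [← Cardinal.eq, ← Cardinal.mul_def, eq_comm]
  refine Cardinal.mul_eq_right (Cardinal.aleph0_le_mk _) ?_ (Cardinal.mk_ne_zero _)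
  exact Cardinal.mk_le_of_injective (f := fun e => Sum.inr e.1)
    (Sum.inr_injective.comp Subtype.val_injective)

open Classical in
/-- The first edge and the label of the tail of the point over `a` with label `t`; `none` if `a` is
a sink. -/
noncomputable def split (G : DirectedGraph.{u, v}) (a : G.V) (t : Label G) :
    Option (G.E × Label G) :=
  if h : Nonempty {e // G.s e = a} then
    some (((nonempty_label_equiv G a h).some t).1.1, ((nonempty_label_equiv G a h).some t).2)
  else none

/-- The label of the point over `s e` with first edge `e` and tail labelled `t`. -/
noncomputable def cons (G : DirectedGraph.{u, v}) (e : G.E) (t : Label G) : Label G :=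
  (nonempty_label_equiv G (G.s e) ⟨⟨e, rfl⟩⟩).some.symm (⟨e, rfl⟩, t)

variable {G : DirectedGraph.{u, v}}

theorem split_cons (e : G.E) (t : Label G) : split G (G.s e) (cons G e t) = some (e, t) := by
  have h : Nonempty {f // G.s f = G.s e} := ⟨⟨e, rfl⟩⟩
  rw [split, dif_pos h, cons, Equiv.apply_symm_apply]

theorem split_eq_some {a : G.V} {t t' : Label G} {e : G.E} (h : split G a t = some (e, t')) :
    G.s e = a ∧ cons G e t' = t := by
  rw [split] at h
  split_ifs at h with hne
  simp only [Option.some.injEq, Prod.mk.injEq] at h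
  obtain ⟨h1, rfl⟩ := h
  have hs : G.s e = a := h1 ▸ ((nonempty_label_equiv G a hne).some t).1.2
  subst hs
  refine ⟨rfl, ?_⟩
  rw [cons, Equiv.symm_apply_eq]
  exact Prod.ext (Subtype.ext h1.symm) rfl

theorem exists_split_eq_some {a : G.V} (t : Label G) {e : G.E} (he : G.s e = a) :
    ∃ f t', split G a t = some (f, t') := by
  have h : Nonempty {f // G.s f = a} := ⟨⟨e, he⟩⟩
  rw [split, dif_pos h]
  exact ⟨_, _, rfl⟩

/-- The points of the space whose functions carry the action: a vertex, a label, and an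
integer that records the degree. -/
abbrev Point (G : DirectedGraph.{u, v}) : Type (max u v) := G.V × Label G × ℤ

variable (K : Type w) [Field K]

open Classical in
/-- A vertex acts on functions by restriction to the points over this vertex. -/
noncomputable def actVertex (a : G.V) : Module.End K (Point G → K) where
  toFun f x := if x.1 = a then f x else 0
  map_add' f g := by ext x; by_cases h : x.1 = a <;> simp [h]
  map_smul' k f := by ext x; by_cases h : x.1 = a <;> simp [h]

open Classical in
/-- An edge acts by the pullback along removing this edge at the front. -/
noncomputable def actEdge (e : G.E) : Module.End K (Point G → K) where
  toFun f x := match split G x.1 x.2.1 with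
    | none => 0
    | some (e', t) => if e' = e then f (G.r e, t, x.2.2 - 1) else 0
  map_add' f g := by
    ext x
    rcases h : split G x.1 x.2.1 with _ | ⟨e', t⟩
    · simp [h]
    · by_cases h' : e' = e <;> simp [h, h']
  map_smul' k f := by
    ext x
    rcases h : split G x.1 x.2.1 with _ | ⟨e', t⟩
    · simp [h]
    · by_cases h' : e' = e <;> simp [h, h']

open Classical in
/-- A ghost edge acts by the pullback along extending by this edge at the front. -/
noncomputable def actGhost (e : G.E) : Module.End K (Point G → K) where
  toFun f x := if x.1 = G.r e then f (G.s e, cons G e x.2.1, x.2.2 + 1) else 0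
  map_add' f g := by ext x; by_cases h : x.1 = G.r e <;> simp [h]
  map_smul' k f := by ext x; by_cases h : x.1 = G.r e <;> simp [h]

variable {K}

open Classical in
theorem actVertex_apply (a : G.V) (f : Point G → K) (x : Point G) :
    actVertex K a f x = if x.1 = a then f x else 0 := rfl

open Classical in
theorem actGhost_apply (e : G.E) (f : Point G → K) (x : Point G) :
    actGhost K e f x = if x.1 = G.r e then f (G.s e, cons G e x.2.1, x.2.2 + 1) else 0 := rfl

theorem actEdge_apply_of_none (e : G.E) (f : Point G → K) {x : Point G}
    (h : split G x.1 x.2.1 = none) : actEdge K e f x = 0 := by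
  simp only [actEdge, LinearMap.coe_mk, AddHom.coe_mk, h]

open Classical in
theorem actEdge_apply_of_some (e : G.E) (f : Point G → K) {x : Point G} {e' : G.E} {t : Label G}
    (h : split G x.1 x.2.1 = some (e', t)) :
    actEdge K e f x = if e' = e then f (G.r e, t, x.2.2 - 1) else 0 := by
  simp only [actEdge, LinearMap.coe_mk, AddHom.coe_mk, h]

variable (K) in
/-- The action of the free algebra on functions. -/
noncomputable def actFree (G : DirectedGraph.{u, v}) :
    FreeAlg K G →ₙₐ[K] Module.End K (Point G → K) :=
  MonoidAlgebra.liftMagma K (FreeSemigroup.lift fun g => match g with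
    | .vertex a => actVertex K a
    | .edge e => actEdge K e
    | .ghost e => actGhost K e)

theorem actFree_fvertex (a : G.V) : actFree K G (fvertex K G a) = actVertex K a := by
  simp [actFree, fvertex, MonoidAlgebra.liftMagma]

theorem actFree_fedge (e : G.E) : actFree K G (fedge K G e) = actEdge K e := by
  simp [actFree, fedge, MonoidAlgebra.liftMagma]

theorem actFree_fghost (e : G.E) : actFree K G (fghost K G e) = actGhost K e := by
  simp [actFree, fghost, MonoidAlgebra.liftMagma]

theorem actFree_eq_of_rel {x y : FreeAlg K G} (h : LeavittRel K G x y) :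
    actFree K G x = actFree K G y := by
  classical
  induction h with
  | vertex_idem a =>
    ext f x
    rw [map_mul, actFree_fvertex, Module.End.mul_apply, actVertex_apply, actVertex_apply]
    split_ifs <;> rfl
  | vertex_orth a b h =>
    ext f x
    rw [map_mul, actFree_fvertex, actFree_fvertex, Module.End.mul_apply, actVertex_apply,
      actVertex_apply, map_zero]
    split_ifs with h1 h2
    · exact absurd (h1.symm.trans h2) h
    · rfl
    · rfl
  | source_edge e =>
    ext f x
    rw [map_mul, actFree_fvertex, actFree_fedge, Module.End.mul_apply, actVertex_apply]
    split_ifs with h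
    · rfl
    · rcases h' : split G x.1 x.2.1 with _ | ⟨e', t⟩
      · rw [actEdge_apply_of_none e f h']
      · rw [actEdge_apply_of_some e f h', if_neg]
        rintro rfl
        exact h (split_eq_some h').1.symm
  | edge_range e =>
    ext f x
    rw [map_mul, actFree_fvertex, actFree_fedge, Module.End.mul_apply]
    rcases h' : split G x.1 x.2.1 with _ | ⟨e', t⟩
    · rw [actEdge_apply_of_none e _ h', actEdge_apply_of_none e _ h']
    · rw [actEdge_apply_of_some e _ h', actEdge_apply_of_some e _ h', actVertex_apply, if_pos rfl]
  | range_ghost e =>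
    ext f x
    rw [map_mul, actFree_fvertex, actFree_fghost, Module.End.mul_apply, actVertex_apply,
      actGhost_apply]
    split_ifs <;> rfl
  | ghost_source e =>
    ext f x
    rw [map_mul, actFree_fvertex, actFree_fghost, Module.End.mul_apply, actGhost_apply,
      actGhost_apply, actVertex_apply, if_pos rfl]
  | ghost_edge e =>
    ext f x
    obtain ⟨a, t, n⟩ := x
    rw [map_mul, actFree_fvertex, actFree_fghost, actFree_fedge, Module.End.mul_apply,
      actGhost_apply, actVertex_apply, actEdge_apply_of_some e _ (split_cons e _), if_pos rfl]
    dsimp only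
    split_ifs with h
    · rw [h, add_sub_cancel_right]
    · rfl
  | ghost_edge_ne e e' h =>
    ext f x
    rw [map_mul, actFree_fghost, actFree_fedge, Module.End.mul_apply, actGhost_apply,
      actEdge_apply_of_some e' _ (split_cons e _), if_neg h, ite_self, map_zero]
    rfl
  | regular a hfin hne =>
    ext f x
    rw [map_sum, actFree_fvertex, LinearMap.sum_apply, Finset.sum_apply, actVertex_apply]
    simp only [map_mul, actFree_fghost, actFree_fedge, Module.End.mul_apply]
    rcases h : split G x.1 x.2.1 with _ | ⟨e, t⟩
    · rw [Finset.sum_eq_zero fun e _ => actEdge_apply_of_none e _ h, if_neg]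
      rintro rfl
      obtain ⟨e, he⟩ := hne
      obtain ⟨f, t, h'⟩ := exists_split_eq_some x.2.1 he
      rw [h] at h'
      cases h'
    · obtain ⟨hs, ht⟩ := split_eq_some h
      rw [Finset.sum_congr rfl fun e _ => actEdge_apply_of_some e _ h, Finset.sum_ite_eq]
      refine if_congr (by simp [hs]) ?_ rfl
      rw [actGhost_apply, if_pos rfl]
      dsimp only
      rw [hs, ht, sub_add_cancel]

theorem actFree_eq_of_leavittCon {x y : FreeAlg K G} (h : leavittCon K G x y) :
    actFree K G x = actFree K G y := by
  change RingConGen.Rel _ x y at h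
  induction h with
  | of x y h =>
    obtain ⟨l, x', y', h, rfl, rfl⟩ := h
    rw [map_smul, map_smul, actFree_eq_of_rel h]
  | refl x => rfl
  | symm _ ih => exact ih.symm
  | trans _ _ ih₁ ih₂ => exact ih₁.trans ih₂
  | add _ _ ih₁ ih₂ => rw [map_add, map_add, ih₁, ih₂]
  | mul _ _ ih₁ ih₂ => rw [map_mul, map_mul, ih₁, ih₂]

variable (K) in
/-- The action of the Leavitt path algebra on functions. -/
noncomputable def act (G : DirectedGraph.{u, v}) :
    LeavittPathAlgebra K G →ₙ+* Module.End K (Point G → K) where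
  toFun := Quotient.lift (actFree K G) fun _ _ h => actFree_eq_of_leavittCon h
  map_zero' := map_zero (actFree K G)
  map_add' := by rintro ⟨x⟩ ⟨y⟩; exact map_add (actFree K G) x y
  map_mul' := by rintro ⟨x⟩ ⟨y⟩; exact map_mul (actFree K G) x y

theorem act_vertex (a : G.V) : act K G (vertex K a) = actVertex K a := actFree_fvertex a

theorem act_ghost (e : G.E) : act K G (ghost K e) = actGhost K e := actFree_fghost e

/-- On functions of the degree alone, a ghost path acts by a shift. -/
theorem act_gpath (a : G.V) (l : List G.E) (hl : G.IsPath a l) (h : ℤ → K) :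
    act K G (gpath K a l) (fun x => h x.2.2)
      = actVertex K (G.endpoint a l) fun x => h (x.2.2 + l.length) := by
  classical
  induction l generalizing a h with
  | nil => rw [gpath_nil, act_vertex]; simp [endpoint]
  | cons e l ih =>
    obtain ⟨rfl, hl⟩ := hl
    have he : act K G (ghost K e) (fun x => h x.2.2)
        = act K G (vertex K (G.r e)) (fun x => h (x.2.2 + 1)) := by
      rw [act_ghost, act_vertex]; rfl
    rw [gpath_cons, map_mul, Module.End.mul_apply, he, ← Module.End.mul_apply, ← map_mul,
      gpath_mul_vertex, ih _ hl fun n => h (n + 1)]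
    simp [endpoint, add_assoc]

theorem vertex_ne_zero (a : G.V) : vertex K a ≠ 0 := by
  intro h
  have h1 := congrFun (congrArg (fun x => act K G x 1) h) (a, .inl 0, 0)
  simp [act_vertex, actVertex_apply] at h1

theorem gpath_ne_vertex {a : G.V} {l : List G.E} (hl : G.IsClosedPath a l) :
    gpath K a l ≠ vertex K a := by
  classical
  intro h
  -- compare the values on the indicator function of degree zero
  have h1 := act_gpath (K := K) a l hl.isPath fun n => if n = 0 then 1 else 0
  rw [h, hl.endpoint_eq, act_vertex] at h1
  have h2 := congrFun h1 (a, .inl 0, 0)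
  simp [actVertex_apply, hl.ne_nil] at h2

/-- The constant functions on the points over `a` are killed by `vertex K a - gpath K a l`. -/
theorem mul_sub_gpath_ne_vertex {a : G.V} {l : List G.E} (hl : G.IsClosedPath a l)
    (b : LeavittPathAlgebra K G) : b * (vertex K a - gpath K a l) ≠ vertex K a := by
  intro h
  have h1 := act_gpath (K := K) a l hl.isPath fun _ => 1
  rw [hl.endpoint_eq, ← act_vertex] at h1
  have h2 := congrFun (congrArg (fun x => act K G x fun _ => 1) h) (a, .inl 0, 0)
  simp only [map_mul, Module.End.mul_apply, map_sub, LinearMap.sub_apply] at h2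
  rw [h1, sub_self, Pi.zero_apply, act_vertex, actVertex_apply, if_pos rfl] at h2
  exact zero_ne_one h2

end Representation
end LeavittPathAlgebra
end DirectedGraph

/-! ### Commutative corners of primitive rings -/

/-- A commutative corner `e R e` of a left primitive ring is a field. Indeed, for `c ≠ 0` in the
corner and `m` with `c m ≠ 0` one has `R c m = M`, so some `b` in the corner satisfies
`b c m = e m`; by commutativity, `b c - e` annihilates `e R e m = e M`. -/
theorem IsLeftPrimitiveRing.exists_inverse {R : Type u} [NonUnitalRing R]
    (hR : IsLeftPrimitiveRing R) {e c : R} (he : IsIdempotentElem e)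
    (hcomm : ∀ a b, Commute (e * a * e) (e * b * e)) (hec : e * c = c) (hce : c * e = c)
    (hc : c ≠ 0) : ∃ b, b * c = e ∧ c * b = e := by
  obtain ⟨M, _, ρ, ⟨-, hsimple⟩, hinj⟩ := hR
  have hgen {x : M} (hx : ρ e x = x) (hx0 : x ≠ 0) (y : M) : ∃ r, ρ r x = y := by
    let N : AddSubgroup M :=
      { carrier := {y | ∃ r, ρ r x = y}
        add_mem' := by
          rintro _ _ ⟨r, rfl⟩ ⟨t, rfl⟩
          exact ⟨r + t, by rw [map_add]; rfl⟩
        zero_mem' := ⟨0, by rw [map_zero]; rfl⟩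
        neg_mem' := by
          rintro _ ⟨r, rfl⟩
          exact ⟨-r, by rw [map_neg]; rfl⟩ }
    have hN := hsimple N (by
      rintro r _ ⟨t, rfl⟩
      exact ⟨r * t, by rw [map_mul]; rfl⟩)
    rcases hN with hN | hN
    · exact absurd ((AddSubgroup.mem_bot).1 (hN ▸ (⟨e, hx⟩ : x ∈ N))) hx0
    · exact (hN ▸ AddSubgroup.mem_top y : y ∈ N)
  have hmul (r t : R) (x : M) : ρ (r * t) x = ρ r (ρ t x) := by rw [map_mul]; rfl
  obtain ⟨m, hm⟩ : ∃ m, ρ c m ≠ 0 := by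
    by_contra! h
    refine hc (hinj ?_)
    ext m
    rw [h, map_zero]; rfl
  have hm' : ρ e m ≠ 0 := by
    intro h
    rw [← hce, hmul, h, map_zero] at hm
    exact hm rfl
  obtain ⟨r, hr⟩ := hgen (by rw [← hmul, hec]) hm (ρ e m)
  have hcc : e * c * e = c := by rw [hec, hce]
  have hbc : e * r * e * c = c * (e * r * e) := by
    have h := (hcomm r c).eq
    rwa [hcc] at h
  have hkey : e * r * e * c = e := by
    refine hinj ?_
    ext y
    obtain ⟨t, ht⟩ := hgen (by rw [← hmul, he]) hm' (ρ e y)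
    have h1 : ρ (e * r * e * c) (ρ e m) = ρ e m := by
      rw [← hmul, mul_assoc _ c, hce, mul_assoc _ e, hec, mul_assoc, hmul, hmul, hr, ← hmul, he.eq]
    have h2 : ρ e y = ρ (e * t * e) (ρ e m) := by
      rw [mul_assoc, hmul, hmul, ← hmul e e m, he.eq, ht, ← hmul, he.eq]
    have h3 : e * r * e * c * (e * t * e) = e * t * e * (e * r * e * c) := by
      have h := (hcomm r t).mul_left (hcomm c t)
      rw [hcc] at h
      exact h.eq
    have h4 : e * r * e * c = e * r * e * c * e := by rw [mul_assoc _ c, hce]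
    calc ρ (e * r * e * c) y = ρ (e * r * e * c) (ρ e y) := by rw [← hmul, ← h4]
      _ = ρ (e * t * e) (ρ (e * r * e * c) (ρ e m)) := by rw [h2, ← hmul, h3, hmul]
      _ = ρ e y := by rw [h1, h2]
  exact ⟨e * r * e, hkey, hbc ▸ hkey⟩

/-- In a commutative corner `e R e` of a primitive ring every non-zero element has an inverse. -/
theorem IsPrimitiveRing.exists_inverse {R : Type u} [NonUnitalRing R]
    (hR : IsPrimitiveRing R) {e c : R} (he : IsIdempotentElem e)
    (hcomm : ∀ a b, Commute (e * a * e) (e * b * e)) (hec : e * c = c) (hce : c * e = c)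
    (hc : c ≠ 0) : ∃ b, b * c = e ∧ c * b = e := by
  rcases hR with hR | hR
  · exact hR.exists_inverse he hcomm hec hce hc
  · have he' : IsIdempotentElem (MulOpposite.op e) := congrArg MulOpposite.op he
    obtain ⟨b, h1, h2⟩ := IsLeftPrimitiveRing.exists_inverse (c := MulOpposite.op c) hR he'
      (fun a b => by
        have h := hcomm b.unop a.unop
        rw [mul_assoc e, mul_assoc e] at h
        exact congrArg MulOpposite.op h.eq)
      (congrArg MulOpposite.op hce) (congrArg MulOpposite.op hec)
      (by rwa [Ne, MulOpposite.op_eq_zero_iff])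
    exact ⟨b.unop, congrArg MulOpposite.unop h2, congrArg MulOpposite.unop h1⟩

namespace DirectedGraph
namespace LeavittPathAlgebra

variable {K : Type w} [Field K] {G : DirectedGraph.{u, v}}

/-! ### Closed paths without exits -/

theorem edge_mul_ghost_of_no_exit {e : G.E} (h : ∀ f, G.s f = G.s e → f = e) :
    edge K e * ghost K e = vertex K (G.s e) := by
  have hF : ∀ f, f ∈ ({e} : Finset G.E) ↔ G.s f = G.s e := fun f => by
    rw [Finset.mem_singleton]
    exact ⟨fun hf => hf ▸ rfl, h f⟩
  rw [vertex_eq_sum _ _ hF (Finset.singleton_nonempty e), Finset.sum_singleton]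

theorem path_mul_gpath_of_no_exit {a : G.V} {l : List G.E} (hl : G.IsPath a l)
    (hexit : ∀ e ∈ l, ∀ f, G.s f = G.s e → f = e) : path K a l * gpath K a l = vertex K a := by
  induction l generalizing a with
  | nil => exact vertex_mul_self a
  | cons e l ih =>
    obtain ⟨rfl, hl⟩ := hl
    rw [path_cons, gpath_cons, mul_assoc, ← mul_assoc (path K _ l),
      ih hl fun e he => hexit e (by simp [he]), vertex_mul_ghost,
      edge_mul_ghost_of_no_exit (hexit e (by simp))]

section NoExit

variable {a : G.V} {l : List G.E} (hl : G.IsClosedPath a l)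
  (hexit : ∀ e ∈ l, ∀ f, G.s f = G.s e → f = e)

include hl in
theorem isPath_flatten_replicate (n : ℕ) :
    G.IsPath a (List.replicate n l).flatten ∧
      G.endpoint a (List.replicate n l).flatten = a := by
  induction n with
  | zero => exact ⟨trivial, rfl⟩
  | succ n ih =>
    rw [List.replicate_succ, List.flatten_cons, isPath_append, endpoint_append, hl.endpoint_eq]
    exact ⟨⟨hl.isPath, ih.1⟩, ih.2⟩

include hl hexit in
/-- Every path from a vertex on a closed path without exits runs around this closed path, so it is
an initial segment of a closed path and has itself no exits. -/
theorem exists_closed_extension {m : List G.E} (hm : G.IsPath a m) :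
    ∃ m', G.IsPath a (m ++ m') ∧ G.endpoint a (m ++ m') = a ∧
      ∀ e ∈ m ++ m', ∀ f, G.s f = G.s e → f = e := by
  have hr := isPath_flatten_replicate hl m.length
  have hx : ∀ e ∈ (List.replicate m.length l).flatten, ∀ f, G.s f = G.s e → f = e := by
    intro e he
    simp only [List.mem_flatten, List.mem_replicate] at he
    obtain ⟨_, ⟨-, rfl⟩, he⟩ := he
    exact hexit e he
  obtain ⟨m', h⟩ := hm.prefix_of_no_exit hr.1 hx (by
    have := List.length_pos_iff.2 hl.ne_nil
    simp only [List.length_flatten, List.map_replicate, List.sum_replicate, smul_eq_mul]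
    exact Nat.le_mul_of_pos_right _ this)
  exact ⟨m', h ▸ hr.1, h ▸ hr.2, h ▸ hx⟩

include hl hexit in
theorem append_comm_of_closed {m n : List G.E} (hm : G.IsPath a m) (hm' : G.endpoint a m = a)
    (hn : G.IsPath a n) (hn' : G.endpoint a n = a) : m ++ n = n ++ m := by
  have h1 : G.IsPath a (m ++ n) := (isPath_append _ _ _).2 ⟨hm, hm'.symm ▸ hn⟩
  have h2 : G.IsPath a (n ++ m) := (isPath_append _ _ _).2 ⟨hn, hn'.symm ▸ hm⟩
  obtain ⟨_, -, -, h⟩ := exists_closed_extension hl hexit h2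
  exact (h1.prefix_of_no_exit h2 (fun e he => h e (List.mem_append_left _ he))
    (by simp [Nat.add_comm])).eq_of_length (by simp [Nat.add_comm])

include hl hexit in
theorem commute_path_path {m n : List G.E} (hm : G.IsPath a m) (hm' : G.endpoint a m = a)
    (hn : G.IsPath a n) (hn' : G.endpoint a n = a) : Commute (path K a m) (path K a n) := by
  have h1 := path_mul_path (K := K) a m n
  have h2 := path_mul_path (K := K) a n m
  rw [hm'] at h1
  rw [hn'] at h2
  rw [Commute, SemiconjBy, h1, h2, append_comm_of_closed hl hexit hm hm' hn hn']

include hl hexit in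
theorem commute_gpath_gpath {m n : List G.E} (hm : G.IsPath a m) (hm' : G.endpoint a m = a)
    (hn : G.IsPath a n) (hn' : G.endpoint a n = a) : Commute (gpath K a m) (gpath K a n) := by
  have h1 := gpath_mul_gpath (K := K) a m n
  have h2 := gpath_mul_gpath (K := K) a n m
  rw [hm'] at h1
  rw [hn'] at h2
  rw [Commute, SemiconjBy, h1, h2, append_comm_of_closed hl hexit hm hm' hn hn']

include hl hexit in
theorem commute_path_gpath {m n : List G.E} (hm : G.IsPath a m) (hm' : G.endpoint a m = a)
    (hn : G.IsPath a n) (hn' : G.endpoint a n = a) : Commute (path K a m) (gpath K a n) := by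
  obtain ⟨_, -, -, h⟩ := exists_closed_extension hl hexit hn
  have h1 := path_mul_gpath_of_no_exit (K := K) hn fun e he => h e (List.mem_append_left _ he)
  have h2 := gpath_mul_path_self (K := K) hn
  rw [hn'] at h2
  have h3 := vertex_mul_path (K := K) a m
  have h4 := path_mul_vertex (K := K) a m
  rw [hm'] at h4
  have h5 := (commute_path_path (K := K) hl hexit hm hm' hn hn').eq
  calc path K a m * gpath K a n
      = gpath K a n * path K a n * (path K a m * gpath K a n) := by
        rw [h2, ← mul_assoc, h3]
    _ = gpath K a n * (path K a m * path K a n) * gpath K a n := by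
        rw [h5]; simp only [mul_assoc]
    _ = gpath K a n * path K a m := by
        rw [← mul_assoc, mul_assoc _ (path K a n), h1, mul_assoc, h4]

include hl hexit in
/-- At a vertex on a closed path without exits the corner is spanned by products `x y*` of closed
paths `x`, `y` and ghosts. -/
theorem corner_mem_span (x : LeavittPathAlgebra K G) :
    vertex K a * x * vertex K a ∈ Submodule.span K {y : LeavittPathAlgebra K G |
      ∃ m n, (G.IsPath a m ∧ G.endpoint a m = a) ∧ (G.IsPath a n ∧ G.endpoint a n = a) ∧
        y = path K a m * gpath K a n} := by
  have hx : x ∈ Submodule.span K {x : LeavittPathAlgebra K G |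
      ∃ a l b m, x = path K a l * gpath K b m} := by
    rw [span_path_mul_gpath]; exact Submodule.mem_top
  induction hx using Submodule.span_induction with
  | mem x hx =>
    obtain ⟨b, m, c, n, rfl⟩ := hx
    by_cases h : a = b ∧ c = a ∧ G.IsPath b m ∧ G.IsPath c n ∧ G.endpoint b m = G.endpoint c n
    · obtain ⟨rfl, rfl, hm, hn, hmn⟩ := h
      rw [← mul_assoc, vertex_mul_path, mul_assoc, gpath_mul_vertex]
      -- continue both paths from their common end to the base point
      obtain ⟨k, hk, hk', hx⟩ := exists_closed_extension hl hexit hm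
      rw [isPath_append] at hk
      refine Submodule.subset_span ⟨m ++ k, n ++ k, ⟨(isPath_append _ _ _).2 hk, hk'⟩,
        ⟨(isPath_append _ _ _).2 ⟨hn, hmn ▸ hk.2⟩, ?_⟩, ?_⟩
      · rw [endpoint_append] at hk' ⊢
        rw [← hmn, hk']
      · rw [← path_mul_path, ← gpath_mul_gpath, mul_assoc, ← mul_assoc (path K _ k), ← hmn,
          path_mul_gpath_of_no_exit hk.2 fun e he => hx e (List.mem_append_right _ he),
          ← mul_assoc, path_mul_vertex]
    · have h0 : vertex K a * (path K b m * gpath K c n) * vertex K a = 0 := by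
        by_cases h1 : a = b
        swap
        · rw [← mul_assoc, vertex_mul_path_of_ne h1, zero_mul, zero_mul]
        by_cases h2 : c = a
        swap
        · rw [mul_assoc, mul_assoc, gpath_mul_vertex_of_ne h2, mul_zero, mul_zero]
        by_cases h3 : G.IsPath b m
        swap
        · rw [path_eq_zero h3, zero_mul, mul_zero, zero_mul]
        by_cases h4 : G.IsPath c n
        swap
        · rw [gpath_eq_zero h4, mul_zero, mul_zero, zero_mul]
        rw [← path_mul_vertex, mul_assoc (path K b m),
          vertex_mul_gpath_of_ne fun h5 => h ⟨h1, h2, h3, h4, h5⟩, mul_zero, mul_zero, zero_mul]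
      rw [h0]; exact Submodule.zero_mem _
  | zero => rw [mul_zero, zero_mul]; exact Submodule.zero_mem _
  | add x y _ _ hx hy => rw [mul_add, add_mul]; exact Submodule.add_mem _ hx hy
  | smul k x _ hx => rw [mul_smul_comm, smul_mul_assoc]; exact Submodule.smul_mem _ _ hx

include hl hexit in
theorem commute_corner (x y : LeavittPathAlgebra K G) :
    Commute (vertex K a * x * vertex K a) (vertex K a * y * vertex K a) := by
  have hx := corner_mem_span (K := K) hl hexit x
  have hy := corner_mem_span (K := K) hl hexit y
  generalize vertex K a * x * vertex K a = x at hx ⊢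
  generalize vertex K a * y * vertex K a = y at hy ⊢
  induction hx, hy using Submodule.span_induction₂ with
  | mem_mem x y hx hy =>
    obtain ⟨m, n, ⟨hm, hm'⟩, ⟨hn, hn'⟩, rfl⟩ := hx
    obtain ⟨p, q, ⟨hp, hp'⟩, ⟨hq, hq'⟩, rfl⟩ := hy
    exact ((commute_path_path hl hexit hm hm' hp hp').mul_right
      (commute_path_gpath hl hexit hm hm' hq hq')).mul_left
      ((commute_path_gpath hl hexit hp hp' hn hn').symm.mul_right
      (commute_gpath_gpath hl hexit hn hn' hq hq'))
  | zero_left y _ => exact Commute.zero_left _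
  | zero_right x _ => exact Commute.zero_right _
  | add_left x y z _ _ _ hx hy => exact hx.add_left hy
  | add_right x y z _ _ _ hx hy => exact hx.add_right hy
  | smul_left k x y _ _ h => exact h.smul_left k
  | smul_right k x y _ _ h => exact h.smul_right k

end NoExit

/-- A closed path without exits would make the corner at its base vertex a field, in which the
non-zero element `vertex K a - gpath K a l` could not be invertible. -/
theorem conditionL_of_isPrimitiveRing (h : IsPrimitiveRing (LeavittPathAlgebra K G)) :
    G.ConditionL := by
  intro a l hl
  by_contra! hexit
  have hexit' : ∀ e ∈ l, ∀ f, G.s f = G.s e → f = e := fun e he f hf =>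
    by_contra fun hne => hexit e he f hne hf
  have hg := vertex_mul_gpath (K := K) a l
  rw [hl.endpoint_eq] at hg
  obtain ⟨b, hb, -⟩ := h.exists_inverse (e := vertex K a) (c := vertex K a - gpath K a l)
    (vertex_mul_self a) (commute_corner hl hexit')
    (by rw [mul_sub, vertex_mul_self, hg]) (by rw [sub_mul, vertex_mul_self, gpath_mul_vertex])
    (sub_ne_zero.2 (gpath_ne_vertex hl).symm)
  exact mul_sub_gpath_ne_vertex hl b hb

/-- If `x a y = k v` with `k ≠ 0`, then `k⁻¹ a y v x` is a non-zero idempotent. -/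
theorem Reduces.exists_idempotent {a : LeavittPathAlgebra K G} (h : Reduces a) :
    ∃ b, a * b ≠ 0 ∧ IsIdempotentElem (a * b) := by
  obtain ⟨x, y, v, k, hk, h⟩ := h
  have hv : k⁻¹ • (x * a * y) = vertex K v := by rw [h, smul_smul, inv_mul_cancel₀ hk, one_smul]
  refine ⟨k⁻¹ • (y * vertex K v * x), ?_, ?_⟩
  · intro h0
    have h1 : x * (a * k⁻¹ • (y * vertex K v * x)) * (a * y)
        = (k⁻¹ • (x * a * y)) * vertex K v * (x * a * y) := by
      simp only [mul_smul_comm, smul_mul_assoc, mul_assoc]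
    rw [h0, mul_zero, zero_mul, hv, h, vertex_mul_self, mul_smul_comm, vertex_mul_self] at h1
    exact smul_ne_zero hk (vertex_ne_zero v) h1.symm
  · have h1 : a * k⁻¹ • (y * vertex K v * x) * (a * k⁻¹ • (y * vertex K v * x))
        = k⁻¹ • (a * y * (vertex K v * (k⁻¹ • (x * a * y)) * vertex K v) * x) := by
      simp only [mul_smul_comm, smul_mul_assoc, mul_assoc]
    rw [IsIdempotentElem, h1, hv, vertex_mul_self, vertex_mul_self, mul_smul_comm]
    simp only [mul_assoc]

end LeavittPathAlgebra
end DirectedGraph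

theorem corollary2 {K : Type w} [Field K] (G : DirectedGraph.{u, v})
    (hprim : IsPrimitiveRing (DirectedGraph.LeavittPathAlgebra K G)) :
    IsZornRing (DirectedGraph.LeavittPathAlgebra K G) := by
  intro a
  by_cases ha : a = 0
  · exact .inl ⟨0, ha⟩
  · exact .inr (DirectedGraph.LeavittPathAlgebra.reduces_of_ne_zero
      (DirectedGraph.LeavittPathAlgebra.conditionL_of_isPrimitiveRing hprim) ha).exists_idempotent
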